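/- **Model.** A weighted graph is a finite connected undirected loopless graph (parallel edges allowed) with positive edge lengths; $L$ denotes the sum of all edge lengths. Nodes are anonymous; the ports at each node (a port, or passage, is an edge together with one of its endpoints) are numbered, and each port carries a marker, initially blank. There are two agents. An adversary chooses their speeds at all times (bounded and nonnegative); one unit of energy lets an agent move by one unit of distance. An agent at a node that receives energy reads the degree of the node, the markers on its ports, and the port through which it entered, and then either stays there (the energy is then lost) or chooses a port, may change the marker on it and traverses the edge continuously. On arrival it reads the markers at the new node, learns the length of the edge that it has just traversed, may change the marker of the port of arrival, and updates its memory. Edges and lengths are unknown beforehand. The cost of a run is the total energy afforded to both agents before the task is completed. *Exploration:* both agents start at the same node, and the task is completed when each point of each edge has been visited by some agent. The agents may communicate at all times, and when they meet inside an edge each may turn around. The algorithm may be randomized, in which case (the speeds being fixed independently of the random choices) cost means expected cost. *Rendezvous:* the agents start at distinct nodes, run two possibly different deterministic programs, each with its own memory, and communicate only through the markers; the task is completed when they are at the same point (a node or a point inside an edge). The agents have *finite memory* if the set of memory states of each agent and the set of markers are finite (fixed for all graphs); otherwise both may be infinite. **Proposition.** Let $\alpha\in\mathbb R$. 1. If some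 exploration algorithm for two agents has cost at most $\alpha L$ on every weighted graph, from every starting node and for all speeds chosen by the adversary, then $\alpha\ge 2$. 2. If some deterministic rendezvous algorithm for two agents has cost at most $\alpha L$ on every weighted graph, from any two distinct starting nodes and for all speeds chosen by the adversary, then $\alpha\ge 5/2$. 3. If, moreover, the agents have finite memory, then $\alpha\ge 3$. -/

import Mathlib

open MeasureTheory Set
open scoped ENNReal NNReal

noncomputable section

/-! ### Weighted graphs with ports -/

/-- A connected undirected graph without loops (parallel edges are allowed) with positive edge
lengths. A *passage* (or *port*) is the intersection of an edge with one of its two endpoints. The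
passages at the node `v` are numbered by `Fin (deg v)`; the two passages of the edge `e` are
`(e, false)` and `(e, true)`; `passage` identifies both descriptions. -/
structure WGraph (V E : Type) where
  deg : V → ℕ
  passage : (Σ v, Fin (deg v)) ≃ E × Bool
  len : E → ℝ
  len_pos : ∀ e, 0 < len e
  loopless : ∀ e, (passage.symm (e, false)).1 ≠ (passage.symm (e, true)).1
  connected : ∀ u v, Relation.ReflTransGen
    (fun a b => ∃ e s, (passage.symm (e, s)).1 = a ∧ (passage.symm (e, !s)).1 = b) u v

namespace WGraph

variable {V E : Type} (G : WGraph V E)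

/-- The node at the end `s` of the edge `e`. -/
def endpoint (e : E) (s : Bool) : V := (G.passage.symm (e, s)).1

/-- The port number of the edge `e` at its end `s`. -/
def port (e : E) (s : Bool) : Fin (G.deg (G.endpoint e s)) := (G.passage.symm (e, s)).2

/-- The sum `L` of all edge lengths. -/
def totalLength [Fintype E] : ℝ := ∑ e, G.len e

/-- The point of the edge `e` at distance `x` from its end `s`, as a distance from the end
`false`. -/
def coord (e : E) (s : Bool) (x : ℝ) : ℝ := if s then G.len e - x else x

/-- Where an agent is: at a node, together with the port through which it has entered (none at the
beginning), or on an edge `e`, which it crosses starting from the end `s` and along which it is now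
at distance `x` from that end. -/
inductive Loc (G : WGraph V E) where
  | node (v : V) (entry : Option (Fin (G.deg v)))
  | edge (e : E) (s : Bool) (x : ℝ)

/-- The physical position of an agent: a node, or an interior point of an edge. -/
def point : G.Loc → V ⊕ (E × ℝ)
  | .node v _ => Sum.inl v
  | .edge e s x =>
      if x ≤ 0 then Sum.inl (G.endpoint e s)
      else if G.len e ≤ x then Sum.inl (G.endpoint e (!s))
      else Sum.inr (e, G.coord e s x)

/-- The effect of moving by a distance `d` (an agent that stays at a node does not move). -/
def advance : G.Loc → ℝ → G.Loc
  | .node v r, _ => .node v r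
  | .edge e s x, d => .edge e s (x + d)

/-- Turning around inside an edge. -/
def turn : G.Loc → G.Loc
  | .node v r => .node v r
  | .edge e s x => .edge e (!s) (G.len e - x)

end WGraph

/-! ### Algorithms -/

/-- The two agents. -/
inductive Agent where
  | ariadne
  | theseus

/-- The other agent. -/
def Agent.other : Agent → Agent
  | .ariadne => .theseus
  | .theseus => .ariadne

/-- What an agent perceives at a node: the degree, the marker on each port of the node, the port
through which it has entered, and whether the other agent is at this node. Nodes are anonymous. -/
structure View (Mk : Type*) where
  deg : ℕ
  mark : Fin deg → Mk
  entry : Option (Fin deg)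
  otherHere : Bool

/-- A deterministic algorithm for a team of two agents under complete communication: `Mem` is the
joint memory of the team, `Mk` is the set of markers that can be written on a passage.
* `depart`: an agent at a node either stays (`none`) or chooses a port, the new marker on that
  port, and the new memory;
* `arrive`: an agent which has crossed an edge reads the markers at the node, learns the length of
  that edge, and chooses the new marker on the port of arrival and the new memory;
* `meet`: when the agents meet inside an edge (at given distances from the ends at which they
  started to cross it), the memory is updated, and each agent may turn around. -/
structure TeamAlg (Mem Mk : Type*) where
  blank : Mk
  init : Mem
  depart : Agent → Mem → (w : View Mk) → Option (Fin w.deg × Mk × Mem)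
  arrive : Agent → Mem → (w : View Mk) → ℝ → Mk × Mem
  meet : Mem → (Agent → ℝ) → Mem × (Agent → Bool)

/-- The deterministic program of a single agent that has its own memory `Mem` and communicates
through the markers on the passages only. -/
structure Program (Mem Mk : Type*) where
  init : Mem
  depart : Mem → (w : View Mk) → Option (Fin w.deg × Mk × Mem)
  arrive : Mem → (w : View Mk) → ℝ → Mk × Mem

/-- A deterministic rendezvous algorithm: one program for each of the two (distinguishable) agents,
with no communication other than through the markers. -/
structure RendezvousAlg (MemA MemT Mk : Type*) where
  blank : Mk
  ariadne : Program MemA Mk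
  theseus : Program MemT Mk

/-- The team in which each agent runs its own program on its own memory. (Rendezvous is complete as
soon as the agents meet, so what happens at a meeting is irrelevant.) -/
def RendezvousAlg.team {MemA MemT Mk : Type*} (R : RendezvousAlg MemA MemT Mk) :
    TeamAlg (MemA × MemT) Mk where
  blank := R.blank
  init := (R.ariadne.init, R.theseus.init)
  depart
    | .ariadne, m, w => (R.ariadne.depart m.1 w).map fun r => (r.1, r.2.1, (r.2.2, m.2))
    | .theseus, m, w => (R.theseus.depart m.2 w).map fun r => (r.1, r.2.1, (m.1, r.2.2))
  arrive
    | .ariadne, m, w, l => ((R.ariadne.arrive m.1 w l).1, ((R.ariadne.arrive m.1 w l).2, m.2))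
    | .theseus, m, w, l => ((R.theseus.arrive m.2 w l).1, (m.1, (R.theseus.arrive m.2 w l).2))
  meet m _ := (m, fun _ => false)

/-! ### Executions -/

/-- The speeds chosen by the adversary, through their integrals: `energy i t` is the total energy
afforded to agent `i` until time `t`. A unit of energy lets the agent move by a unit distance. The
functions below are exactly the integrals of bounded measurable nonnegative speeds. -/
structure Schedule where
  energy : Agent → ℝ → ℝ
  energy_zero : ∀ i, energy i 0 = 0
  mono : ∀ i, Monotone (energy i)
  lipschitz : ∃ K : ℝ≥0, ∀ i, LipschitzWith K (energy i)

/-- The total energy afforded to the two agents until time `t`. -/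
def Schedule.total (σ : Schedule) (t : ℝ) : ℝ := σ.energy .ariadne t + σ.energy .theseus t

/-- A configuration: the locations of the agents, the markers on the passages, the memory, whether
the agents have just met inside an edge (and have not reacted yet), the points of the edges that
some agent has visited (an edge and the distance from its end `false`), and whether the agents have
ever been at the same point. -/
structure Config {V E : Type} (G : WGraph V E) (Mem Mk : Type*) where
  loc : Agent → G.Loc
  mark : E × Bool → Mk
  mem : Mem
  pending : Prop
  seen : Set (E × ℝ)
  met : Prop

section Dynamics

variable {V E : Type} {Mem Mk : Type*} (G : WGraph V E) (alg : TeamAlg Mem Mk)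

/-- The initial configuration: the passages carry the blank marker. -/
def initConfig (start : Agent → V) : Config G Mem Mk where
  loc i := .node (start i) none
  mark _ := alg.blank
  mem := alg.init
  pending := False
  seen := ∅
  met := start .ariadne = start .theseus

variable {G}

open Classical in
/-- What agent `i` perceives at the node `v`, entered through the port `r`. -/
def Config.view (c : Config G Mem Mk) (i : Agent) (v : V) (r : Option (Fin (G.deg v))) :
    View Mk where
  deg := G.deg v
  mark p := c.mark (G.passage ⟨v, p⟩)
  entry := r
  otherHere := decide (∃ r', c.loc i.other = .node v r')

open Classical in
/-- Agent `i` leaves a node through the passage `q`, on which it writes `k`. -/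
def Config.afterDepart (c : Config G Mem Mk) (i : Agent) (q : E × Bool) (k : Mk) (m : Mem) :
    Config G Mem Mk :=
  { c with
    loc := Function.update c.loc i (.edge q.1 q.2 0)
    mark := Function.update c.mark q k
    mem := m }

open Classical in
/-- Agent `i` arrives at the end `s` of the edge `e`, and writes `k` on the passage `(e, s)`. -/
def Config.afterArrive (c : Config G Mem Mk) (i : Agent) (e : E) (s : Bool) (k : Mk) (m : Mem) :
    Config G Mem Mk :=
  { c with
    loc := Function.update c.loc i (.node (G.endpoint e s) (some (G.port e s)))
    mark := Function.update c.mark (e, s) k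
    mem := m }

/-- The reaction of the team to a meeting inside an edge at distances `x`. -/
def Config.afterMeet (c : Config G Mem Mk) (x : Agent → ℝ) : Config G Mem Mk :=
  { c with
    loc := fun i => if (alg.meet c.mem x).2 i then G.turn (c.loc i) else c.loc i
    mem := (alg.meet c.mem x).1
    pending := False }

variable (σ : Schedule)

/-- The location at time `u` of agent `i`, if it has been moving since time `t`. -/
def Config.locAt (c : Config G Mem Mk) (t : ℝ) (i : Agent) (u : ℝ) : G.Loc :=
  G.advance (c.loc i) (σ.energy i u - σ.energy i t)

/-- The agents are at the same point at time `u`. -/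
def Config.sameAt (c : Config G Mem Mk) (t u : ℝ) : Prop :=
  G.point (c.locAt σ t .ariadne u) = G.point (c.locAt σ t .theseus u)

/-- The agents are at the same interior point of an edge at time `u`. -/
def Config.sameInsideAt (c : Config G Mem Mk) (t u : ℝ) : Prop :=
  ∃ q : E × ℝ, G.point (c.locAt σ t .ariadne u) = Sum.inr q ∧
    G.point (c.locAt σ t .theseus u) = Sum.inr q

/-- Between the times `t` and `t'`, agent `i` has nothing to do but to use its energy: if it is at a
node and receives energy, then its algorithm tells it to stay there (and that energy is lost); if it
is on an edge, then it has not crossed it before time `t'`. -/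
def Config.CanMove (c : Config G Mem Mk) (t t' : ℝ) (i : Agent) : Prop :=
  match c.loc i with
  | .node v r => σ.energy i t' = σ.energy i t ∨ alg.depart i c.mem (c.view i v r) = none
  | .edge e _ x => x < G.len e ∧ x + (σ.energy i t' - σ.energy i t) ≤ G.len e

/-- The configuration at time `t'`, if the agents have been moving since time `t`. -/
def Config.afterMove (c : Config G Mem Mk) (t t' : ℝ) : Config G Mem Mk :=
  { c with
    loc := fun i => c.locAt σ t i t'
    pending := c.sameInsideAt σ t t' ∧ ¬ ∀ u ∈ Icc t t', c.sameAt σ t u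
    seen := c.seen ∪ {q | ∃ i s x, c.loc i = .edge q.1 s x ∧
      ∃ z ∈ Icc x (x + (σ.energy i t' - σ.energy i t)), q.2 = G.coord q.1 s z}
    met := c.met ∨ ∃ u ∈ Icc t t', c.sameAt σ t u }

variable (G)

/-- `Reach G alg σ start t c`: when the agents run `alg` on `G` from the nodes `start`, and receive
energy according to `σ`, they can be in the configuration `c` at time `t`. The agents move
continuously on the edges; taking a decision at a node, or at a meeting inside an edge, takes no
time. A move may not extend beyond the time at which the agents meet inside an edge, unless they are
together during the whole move. -/
inductive Reach (start : Agent → V) : ℝ → Config G Mem Mk → Prop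
  | init : Reach start 0 (initConfig G alg start)
  | depart {t : ℝ} {c : Config G Mem Mk} (i : Agent) (v : V) (r : Option (Fin (G.deg v)))
      (p : Fin (G.deg v)) (k : Mk) (m : Mem) :
      Reach start t c → c.loc i = .node v r →
      alg.depart i c.mem (c.view i v r) = some (p, k, m) →
      Reach start t (c.afterDepart i (G.passage ⟨v, p⟩) k m)
  | arrive {t : ℝ} {c : Config G Mem Mk} (i : Agent) (e : E) (s : Bool) (k : Mk) (m : Mem) :
      Reach start t c → c.loc i = .edge e (!s) (G.len e) →
      alg.arrive i c.mem (c.view i (G.endpoint e s) (some (G.port e s))) (G.len e) = (k, m) →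
      Reach start t (c.afterArrive i e s k m)
  | meet {t : ℝ} {c : Config G Mem Mk} (e : E) (s : Agent → Bool) (x : Agent → ℝ) :
      Reach start t c → c.pending → (∀ i, c.loc i = .edge e (s i) (x i)) →
      Reach start t (c.afterMeet alg x)
  | move {t t' : ℝ} {c : Config G Mem Mk} :
      Reach start t c → t ≤ t' → ¬ c.pending → (∀ i, c.CanMove alg σ t t' i) →
      ((∀ u ∈ Ioo t t', ¬ c.sameInsideAt σ t u) ∨ ∀ u ∈ Icc t t', c.sameAt σ t u) →
      Reach start t' (c.afterMove σ t t')

variable {G}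

/-- Exploration is complete: each point inside each edge has been visited by some agent. -/
def Config.Explored (c : Config G Mem Mk) : Prop :=
  ∀ e, ∀ y ∈ Ioo 0 (G.len e), (e, y) ∈ c.seen

variable (G)

/-- The cost of exploration from the node `v`: the energy afforded before completion. -/
def explorationCost (v : V) : ℝ≥0∞ :=
  ⨆ (t : ℝ) (c : Config G Mem Mk) (_ : Reach G alg σ (fun _ => v) t c) (_ : ¬ c.Explored),
    ENNReal.ofReal (σ.total t)

/-- The cost of rendezvous from the nodes `start`: the energy afforded before the agents meet, at a
node or inside an edge. -/
def rendezvousCost (start : Agent → V) : ℝ≥0∞ :=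
  ⨆ (t : ℝ) (c : Config G Mem Mk) (_ : Reach G alg σ start t c) (_ : ¬ c.met),
    ENNReal.ofReal (σ.total t)

end Dynamics

/-- The possibly randomized exploration algorithm, which runs `alg ω` for a random `ω` of law `P`,
has expected cost at most `α L` on every weighted graph, from every node, and for all speeds. (A
deterministic algorithm is the case of a one-point `Ω`.) -/
def ExplorationCostLE {Ω : Type*} [MeasurableSpace Ω] (P : Measure Ω) {Mem Mk : Type*}
    (alg : Ω → TeamAlg Mem Mk) (α : ℝ) : Prop :=
  ∀ (V E : Type) [Finite V] [Fintype E] (G : WGraph V E) (v : V) (σ : Schedule),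
    ∫⁻ ω, explorationCost G (alg ω) σ v ∂P ≤ ENNReal.ofReal (α * G.totalLength)

/-- The rendezvous algorithm `R` has cost at most `α L` on every weighted graph, from any two
distinct nodes, and for all speeds. -/
def RendezvousCostLE {MemA MemT Mk : Type*} (R : RendezvousAlg MemA MemT Mk) (α : ℝ) : Prop :=
  ∀ (V E : Type) [Finite V] [Fintype E] (G : WGraph V E) (start : Agent → V),
    start .ariadne ≠ start .theseus → ∀ σ : Schedule,
      rendezvousCost G R.team σ start ≤ ENNReal.ofReal (α * G.totalLength)

end

/-! Exploration: on a star with `N + 1` unit edges, let Ariadne alone receive energy, at a speed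
fixed in advance. She has to return to the center between two new edges, so whatever the random
choices, some edge is still unvisited after `2 * N` units of energy (`explorationCost_starGraph`),
and the ratio `2N / (N + 1)` tends to two.

Rendezvous: since the programs are deterministic, the adversary can build the schedule while
watching the run (`Playable.extend`), and an agent that stays at a node forever wastes unbounded
energy. Suppose that the ratio is less than three. An agent that has crossed its first edge and sees
through which port the other one has left must follow it: otherwise, on a path whose middle edge
carries almost all the length, that edge would be crossed three times (`three_mul_le_of_return`). So
far, local views do not tell this path from a cycle with two nodes and edges of lengths `e` and `f`.
On the cycle, both agents therefore turn in the same direction and are back at their initial nodes,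
without having met, at cost `2 * (e + f)`. Now Ariadne is frozen and Theseus crosses a third edge,
of his choice (`cycle_third_crossing`). With `e = f` this gives `5 / 2`.

To reach three, the edge that he chooses must be much longer than the other. His memory when he
leaves for the second time depends on `f` only, and together with `e` it determines his choice
(`RendezvousCostLE.exists_third_choice`). If his memory is finite, two values of `f` of very
different magnitudes give the same memory. For a value of `e` far from both and between them, he
makes the same choice in both cycles, and in one of them it is the long edge. -/

/-- The schedule that follows `σ` until time `t`, then gives the constant speeds `d`. -/
def Schedule.extend (σ : Schedule) (t : ℝ) (ht : 0 ≤ t) (d : Agent → ℝ) (hd : ∀ i, 0 ≤ d i) :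
    Schedule where
  energy i s := σ.energy i (min s t) + d i * max (s - t) 0
  energy_zero i := by simp [ht, σ.energy_zero]
  mono i x y h := by
    have h1 := σ.mono i (min_le_min_right t h)
    have h2 := mul_le_mul_of_nonneg_left (max_le_max_right 0 (sub_le_sub_right h t)) (hd i)
    exact add_le_add h1 h2
  lipschitz := by
    obtain ⟨K, hK⟩ := σ.lipschitz
    refine ⟨K + ((d .ariadne).toNNReal + (d .theseus).toNNReal), fun i => ?_⟩
    have h1 : LipschitzWith K fun s => σ.energy i (min s t) := by
      simpa [Function.comp_def] using (hK i).comp (LipschitzWith.id.min_const t)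
    have h2 : LipschitzWith ((d .ariadne).toNNReal + (d .theseus).toNNReal)
        fun s => d i * max (s - t) 0 := by
      have h3 : LipschitzWith 1 fun s : ℝ => max (s - t) 0 :=
        LipschitzWith.of_le_add_mul _ fun x y => by
          rw [Real.dist_eq, NNReal.coe_one, one_mul]
          rcases max_cases (x - t) 0 with h | h <;> rcases max_cases (y - t) 0 with h' | h' <;>
            linarith [le_abs_self (x - y), abs_nonneg (x - y)]
      refine LipschitzWith.of_dist_le_mul fun x y => ?_
      have h4 := h3.dist_le_mul x y
      rw [Real.dist_eq] at h4 ⊢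
      rw [← mul_sub, abs_mul, abs_of_nonneg (hd i)]
      have h5 : d i ≤ ((d .ariadne).toNNReal + (d .theseus).toNNReal : ℝ≥0) := by
        push_cast
        rw [Real.coe_toNNReal _ (hd _), Real.coe_toNNReal _ (hd _)]
        cases i
        · linarith [hd .theseus]
        · linarith [hd .ariadne]
      have h6 : |max (x - t) 0 - max (y - t) 0| ≤ dist x y := by simpa using h4
      exact mul_le_mul h5 h6 (abs_nonneg _) (NNReal.coe_nonneg _)
    exact h1.add h2

/-! ### Schedules built adaptively by the adversary -/

section Reachability

variable {V E : Type} {Mem Mk : Type*} {G : WGraph V E} {alg : TeamAlg Mem Mk} {σ : Schedule}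
  {start : Agent → V}

theorem Reach.nonneg {t : ℝ} {c : Config G Mem Mk} (h : Reach G alg σ start t c) : 0 ≤ t := by
  induction h with
  | init => exact le_rfl
  | move _ h _ _ _ ih => exact ih.trans h
  | _ => assumption

/-- What can be reached at time `t` depends on the schedule until time `t` only. -/
theorem Reach.congr {t : ℝ} {c : Config G Mem Mk} (h : Reach G alg σ start t c) {σ' : Schedule}
    (hσ : ∀ i, ∀ s ≤ t, σ'.energy i s = σ.energy i s) : Reach G alg σ' start t c := by
  induction h with
  | init => exact .init
  | depart i v r p k m _ hl hd ih => exact .depart i v r p k m (ih hσ) hl hd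
  | arrive i e s k m _ hl hd ih => exact .arrive i e s k m (ih hσ) hl hd
  | meet e s x _ hp hl ih => exact .meet e s x (ih hσ) hp hl
  | @move t t' c _ htt hp hc hs ih =>
    have h0 : ∀ i, ∀ u ≤ t', σ'.energy i u - σ'.energy i t = σ.energy i u - σ.energy i t :=
      fun i u hu => by rw [hσ i u hu, hσ i t htt]
    have h1 : ∀ i, ∀ u ≤ t', c.locAt σ' t i u = c.locAt σ t i u := fun i u hu => by
      rw [Config.locAt, Config.locAt, h0 i u hu]
    have h2 : ∀ u ≤ t', c.sameAt σ' t u = c.sameAt σ t u := fun u hu => by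
      rw [Config.sameAt, Config.sameAt, h1 _ u hu, h1 _ u hu]
    have h3 : ∀ u ≤ t', c.sameInsideAt σ' t u = c.sameInsideAt σ t u := fun u hu => by
      rw [Config.sameInsideAt, Config.sameInsideAt, h1 _ u hu, h1 _ u hu]
    have h4 : (∀ u ∈ Icc t t', c.sameAt σ' t u) = ∀ u ∈ Icc t t', c.sameAt σ t u :=
      by
      refine propext (forall₂_congr fun u hu => ?_)
      rw [h2 u hu.2]
    have h5 : (∃ u ∈ Icc t t', c.sameAt σ' t u) = ∃ u ∈ Icc t t', c.sameAt σ t u := by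
      refine propext (exists_congr fun u => and_congr_right fun hu => ?_)
      rw [h2 u hu.2]
    -- The fields of the new configuration mention the schedule itself, so the two configurations
    -- have to be identified before `Reach.move` applies.
    have h6 : c.afterMove σ' t t' = c.afterMove σ t t' := by
      unfold Config.afterMove
      congr 1
      · funext i
        exact h1 i t' le_rfl
      · rw [h3 t' le_rfl, h4]
      · simp only [h0 _ t' le_rfl]
      · rw [h5]
    rw [← h6]
    refine .move (ih fun i s hs => hσ i s (hs.trans htt)) htt hp (fun i => ?_) ?_
    · have := hc i
      unfold Config.CanMove at this ⊢
      rwa [hσ i t' le_rfl, hσ i t htt]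
    · rw [h4]
      refine hs.imp_left fun h u hu => ?_
      rw [h3 u hu.2.le]
      exact h u hu

variable (G alg start) in
/-- Some schedule leads the agents, without a meeting, to a configuration in which the agent `i` is
at `a`, the other agent is at `b`, the markers are `μ`, the memory is `m`, and the energy afforded
is `w`. -/
def Playable (i : Agent) (a b : G.Loc) (μ : E × Bool → Mk) (m : Mem) (w : ℝ) : Prop :=
  ∃ (σ : Schedule) (t : ℝ) (c : Config G Mem Mk), Reach G alg σ start t c ∧ c.loc i = a ∧
    c.loc i.other = b ∧ c.mark = μ ∧ c.mem = m ∧ ¬ c.pending ∧ ¬ c.met ∧ σ.total t = w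

@[simp] theorem Agent.other_other (i : Agent) : i.other.other = i := by cases i <;> rfl

theorem Agent.other_ne (i : Agent) : i.other ≠ i := by cases i <;> simp [Agent.other]

namespace Playable

variable {i : Agent} {a b : G.Loc} {μ : E × Bool → Mk} {m m' : Mem} {w : ℝ}

theorem symm (h : Playable G alg start i a b μ m w) : Playable G alg start i.other b a μ m w := by
  obtain ⟨σ, t, c, h, ha, hb, hr⟩ := h
  exact ⟨σ, t, c, h, hb, by rwa [i.other_other], hr⟩

theorem init (h : start .ariadne ≠ start .theseus) (i : Agent) :
    Playable G alg start i (.node (start i) none) (.node (start i.other) none) (fun _ => alg.blank)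
      alg.init 0 := by
  refine ⟨⟨fun _ _ => 0, fun _ => rfl, fun _ => monotone_const,
    0, fun _ => LipschitzWith.const _⟩, 0, _, .init, rfl, rfl, rfl, rfl, not_false, h, ?_⟩
  simp [Schedule.total]

theorem depart [DecidableEq E] {v : V} {r : Option (Fin (G.deg v))} {p : Fin (G.deg v)} {k : Mk}
    {ν : Fin (G.deg v) → Mk}
    (h : Playable G alg start i (.node v r) b μ m w) (hb : ∀ r', b ≠ .node v r')
    (hν : ∀ q, μ (G.passage ⟨v, q⟩) = ν q)
    (hd : alg.depart i m ⟨G.deg v, ν, r, false⟩ = some (p, k, m')) {e : E} {s : Bool}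
    (hq : G.passage ⟨v, p⟩ = (e, s)) :
    Playable G alg start i (.edge e s 0) b (Function.update μ (e, s) k) m' w := by
  obtain ⟨σ, t, c, h, ha, rfl, rfl, rfl, hp, hm, hw⟩ := h
  obtain rfl : ν = _ := funext fun q => (hν q).symm
  -- The flag `otherHere` of the actual view is a `decide`; quantifying over it avoids rewriting
  -- inside a view on which the type of the port depends.
  have hv : ∀ o : Bool, o = false → alg.depart i c.mem
      ⟨G.deg v, fun q => c.mark (G.passage ⟨v, q⟩), r, o⟩ = some (p, k, m') := by
    rintro _ rfl
    exact hd
  refine ⟨σ, t, _, .depart i v r p k m' h ha (hv _ (by simpa using hb)), ?_, ?_, ?_, rfl, hp, hm,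
    hw⟩
  · simp [Config.afterDepart, hq]
  · simp [Config.afterDepart, i.other_ne]
  · funext q'
    by_cases hq' : q' = (e, s)
    · subst hq'
      simp [Config.afterDepart, hq]
    · simp [Config.afterDepart, hq, hq']

theorem arrive [DecidableEq E] {e : E} {s : Bool} {k : Mk}
    {ν : Fin (G.deg (G.endpoint e s)) → Mk}
    (h : Playable G alg start i (.edge e (!s) (G.len e)) b μ m w)
    (hb : ∀ r', b ≠ .node (G.endpoint e s) r')
    (hν : ∀ q, μ (G.passage ⟨G.endpoint e s, q⟩) = ν q)
    (hd : alg.arrive i m ⟨G.deg (G.endpoint e s), ν, some (G.port e s), false⟩ (G.len e) =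
      (k, m')) :
    Playable G alg start i (.node (G.endpoint e s) (some (G.port e s))) b
      (Function.update μ (e, s) k) m' w := by
  obtain ⟨σ, t, c, h, ha, rfl, rfl, rfl, hp, hm, hw⟩ := h
  obtain rfl : ν = _ := funext fun q => (hν q).symm
  have hv : c.view i (G.endpoint e s) (some (G.port e s)) =
      ⟨_, fun q => c.mark (G.passage ⟨G.endpoint e s, q⟩), some (G.port e s), false⟩ := by
    unfold Config.view
    congr 1
    simpa using hb
  refine ⟨σ, t, _, .arrive i e s k m' h ha (by rw [hv]; exact hd), ?_, ?_, ?_, rfl, hp, hm, hw⟩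
  · simp [Config.afterArrive]
  · simp [Config.afterArrive, i.other_ne]
  · funext q'
    by_cases hq : q' = (e, s)
    · subst hq
      simp [Config.afterArrive]
    · simp [Config.afterArrive, hq]

end Playable

@[simp] theorem WGraph.advance_zero (G : WGraph V E) (a : G.Loc) : G.advance a 0 = a := by
  cases a <;> simp [WGraph.advance]

/-- Using the energy `d`, starting at `a`, does not require a decision. -/
def WGraph.Free (G : WGraph V E) (a : G.Loc) (d : ℝ) : Prop :=
  match a with
  | .node _ _ => d = 0
  | .edge e _ x => x < G.len e ∧ x + d ≤ G.len e

namespace Playable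

variable {i : Agent} {a b : G.Loc} {μ : E × Bool → Mk} {m m' : Mem} {w : ℝ}

/-- One unit of time with the constant speeds `d` and `d'` is appended to the schedule; by
`Reach.congr`, this does not affect what has been reached before. After a fraction `z` of that time
the agents have used `z * d` and `z * d'`, whence the form of `hne`. The second case of `ha` is that
of an agent that decides to stay and loses its energy. -/
theorem extend (h : Playable G alg start i a b μ m w) {d d' : ℝ} (hd : 0 ≤ d) (hd' : 0 ≤ d')
    (ha : G.Free a d ∨ ∃ v r, a = .node v r ∧ (∀ r', b ≠ .node v r') ∧
      alg.depart i m ⟨G.deg v, fun q => μ (G.passage ⟨v, q⟩), r, false⟩ = none)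
    (hb : G.Free b d')
    (hne : ∀ z ∈ Icc (0 : ℝ) 1, G.point (G.advance a (z * d)) ≠ G.point (G.advance b (z * d'))) :
    Playable G alg start i (G.advance a d) (G.advance b d') μ m (w + d + d') := by
  obtain ⟨σ, t, c, h, rfl, rfl, rfl, rfl, hp, hm, rfl⟩ := h
  classical
  set D : Agent → ℝ := fun j => if j = i then d else d' with hD
  have hD0 : ∀ j, 0 ≤ D j := fun j => by
    by_cases hj : j = i <;> simp [hD, hj, hd, hd']
  have hDi : D i = d := by simp [hD]
  have hDo : D i.other = d' := by simp [hD, i.other_ne]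
  set τ := σ.extend t h.nonneg D hD0 with hτ
  have hE : ∀ j, ∀ s ≤ t, τ.energy j s = σ.energy j s := fun j s hs => by
    simp [hτ, Schedule.extend, hs]
  have hE' : ∀ j, ∀ z, 0 ≤ z → τ.energy j (t + z) - τ.energy j t = z * D j := fun j z hz => by
    simp [hτ, Schedule.extend, hz, mul_comm]
  have hE1 : ∀ j, τ.energy j (t + 1) - τ.energy j t = D j := fun j => by
    simpa using hE' j 1 zero_le_one
  have hloc : ∀ j, ∀ z, 0 ≤ z → c.locAt τ t j (t + z) = G.advance (c.loc j) (z * D j) :=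
    fun j z hz => by rw [Config.locAt, hE' j z hz]
  have hloc1 : ∀ j, c.locAt τ t j (t + 1) = G.advance (c.loc j) (D j) :=
    fun j => by simpa using hloc j 1 zero_le_one
  have hsame : ∀ u ∈ Icc t (t + 1), ¬ c.sameAt τ t u := by
    intro u hu hs
    obtain ⟨z, rfl⟩ : ∃ z, u = t + z := ⟨u - t, by ring⟩
    have hz : z ∈ Icc (0 : ℝ) 1 := ⟨by linarith [hu.1], by linarith [hu.2]⟩
    have := hne z hz
    rw [Config.sameAt, hloc _ _ hz.1, hloc _ _ hz.1] at hs
    rw [← hDi, ← hDo] at this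
    cases i
    · exact this hs
    · exact this hs.symm
  have hins : ∀ u ∈ Icc t (t + 1), ¬ c.sameInsideAt τ t u := by
    rintro u hu ⟨q, h1, h2⟩
    exact hsame u hu (h1.trans h2.symm)
  have hfree : ∀ j, G.Free (c.loc j) (D j) → c.CanMove alg τ t (t + 1) j := by
    intro j hj
    unfold WGraph.Free at hj
    unfold Config.CanMove
    cases hl : c.loc j with
    | node v r =>
      rw [hl] at hj
      left
      linarith [hE1 j, show D j = 0 from hj]
    | edge e s x =>
      rw [hl] at hj
      simpa only [hE1 j] using hj
  have hcan : ∀ j, c.CanMove alg τ t (t + 1) j := by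
    intro j
    by_cases hj : j = i
    · subst hj
      rcases ha with ha | ⟨v, r, ha, hb', hn⟩
      · exact hfree _ (by rwa [hDi])
      · unfold Config.CanMove
        rw [ha]
        right
        have hv : c.view j v r = ⟨G.deg v, fun q => c.mark (G.passage ⟨v, q⟩), r, false⟩ := by
          unfold Config.view
          congr 1
          simpa using hb'
        rw [hv]
        exact hn
    · obtain rfl : j = i.other := by cases i <;> cases j <;> simp_all [Agent.other]
      exact hfree _ (by rwa [hDo])
  have hT : τ.total (t + 1) = σ.total t + d + d' := by
    have h1 := hE1 i
    have h2 := hE1 i.other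
    rw [hDi, hE i t le_rfl] at h1
    rw [hDo, hE i.other t le_rfl] at h2
    unfold Schedule.total
    cases i
    · simp only [Agent.other] at h2
      linarith
    · simp only [Agent.other] at h2
      linarith
  refine ⟨τ, t + 1, _, .move (h.congr hE) (by linarith) hp hcan
    (.inl fun u hu => hins u ⟨hu.1.le, hu.2.le⟩), ?_, ?_, rfl, rfl, ?_, ?_, hT⟩
  · simp only [Config.afterMove, hloc1, hDi]
  · simp only [Config.afterMove, hloc1, hDo]
  · exact fun hpend => hins _ ⟨by linarith, le_rfl⟩ hpend.1
  · rintro (h | ⟨u, hu, hs⟩)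
    · exact hm h
    · exact hsame u hu hs

theorem move (h : Playable G alg start i a b μ m w) {d d' : ℝ} (hd : 0 ≤ d) (hd' : 0 ≤ d')
    (ha : G.Free a d) (hb : G.Free b d')
    (hne : ∀ z ∈ Icc (0 : ℝ) 1, G.point (G.advance a (z * d)) ≠ G.point (G.advance b (z * d'))) :
    Playable G alg start i (G.advance a d) (G.advance b d') μ m (w + d + d') :=
  h.extend hd hd' (.inl ha) hb hne

/-- The energy of an agent that stays at a node is lost. -/
theorem stay {v : V} {r : Option (Fin (G.deg v))} {ν : Fin (G.deg v) → Mk}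
    (h : Playable G alg start i (.node v r) b μ m w) (hb : G.Free b 0) (hne : G.point b ≠ .inl v)
    (hν : ∀ q, μ (G.passage ⟨v, q⟩) = ν q)
    (hd : alg.depart i m ⟨G.deg v, ν, r, false⟩ = none) {d : ℝ} (h0 : 0 ≤ d) :
    Playable G alg start i (.node v r) b μ m (w + d) := by
  obtain rfl : ν = _ := funext fun q => (hν q).symm
  have hb' : ∀ r', b ≠ .node v r' := by
    rintro r' rfl
    exact hne rfl
  have h1 := h.extend h0 le_rfl (.inr ⟨v, r, rfl, hb', hd⟩) hb fun z _ => by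
    rw [mul_zero, G.advance_zero]
    exact hne.symm
  rwa [add_zero, G.advance_zero] at h1

/-- The energy afforded before the agents meet is at most the cost. -/
theorem energy_le (h : Playable G alg start i a b μ m w) {B : ℝ} (hB : 0 ≤ B)
    (hc : ∀ σ, rendezvousCost G alg σ start ≤ ENNReal.ofReal B) : w ≤ B := by
  obtain ⟨σ, t, c, h, -, -, -, -, -, hm, rfl⟩ := h
  have h1 : ENNReal.ofReal (σ.total t) ≤ rendezvousCost G alg σ start :=
    le_iSup₂_of_le t c (le_iSup₂_of_le h hm le_rfl)
  exact (ENNReal.ofReal_le_ofReal_iff hB).1 (h1.trans (hc σ))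

end Playable

end Reachability

/-! ### Exploration of a star -/

section Exploration

/-- Only Ariadne moves, at unit speed. -/
noncomputable def Schedule.solo : Schedule where
  energy
    | .ariadne, t => max t 0
    | .theseus, _ => 0
  energy_zero i := by cases i <;> simp
  mono i := by
    cases i
    · exact fun x y h => max_le_max_right 0 h
    · exact monotone_const
  lipschitz := by
    refine ⟨1, fun i => ?_⟩
    cases i
    · exact LipschitzWith.id.max_const 0
    · exact LipschitzWith.const' _

variable {V E : Type} {Mem Mk : Type*} {G : WGraph V E} {alg : TeamAlg Mem Mk}
  {start : Agent → V}

/-- Theseus remains at a node, so no meeting inside an edge can interrupt the move, and only the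
edge on which Ariadne moves gains visited points. -/
theorem Reach.solo_move {t d : ℝ} {c : Config G Mem Mk} (h : Reach G alg .solo start t c)
    (hd : 0 ≤ d) (hp : ¬ c.pending) {v₀ : V} {r₀ : Option (Fin (G.deg v₀))}
    (hT : c.loc .theseus = .node v₀ r₀)
    (hA : c.CanMove alg .solo t (t + d) .ariadne) :
    Reach G alg .solo start (t + d) (c.afterMove .solo t (t + d)) ∧
      ¬ (c.afterMove .solo t (t + d)).pending ∧
      (c.afterMove .solo t (t + d)).loc .theseus = .node v₀ r₀ ∧
      (c.afterMove .solo t (t + d)).loc .ariadne = G.advance (c.loc .ariadne) d ∧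
      (c.afterMove .solo t (t + d)).seen ⊆
        c.seen ∪ {q | ∃ s x, c.loc .ariadne = .edge q.1 s x} := by
  have hin : ∀ u, ¬ c.sameInsideAt .solo t u := by
    rintro u ⟨q, -, hq⟩
    rw [Config.locAt, hT] at hq
    cases hq
  refine ⟨.move h (by linarith) hp (fun i => ?_) (.inl fun u _ => hin u), fun hq => hin _ hq.1,
    ?_, ?_, ?_⟩
  · cases i
    · exact hA
    · unfold Config.CanMove
      rw [hT]
      exact .inl rfl
  · simp only [Config.afterMove, Config.locAt, hT, WGraph.advance]
  · have h0 := h.nonneg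
    simp only [Config.afterMove, Config.locAt, Schedule.solo]
    rw [max_eq_left h0, max_eq_left (by linarith), add_sub_cancel_left]
  · refine union_subset_union_right _ ?_
    rintro q ⟨i, s, x, hi, -⟩
    cases i
    · exact ⟨s, x, hi⟩
    · rw [hT] at hi
      cases hi

/-- When the edges have unit length, Ariadne stays at her node or crosses an edge in unit time. -/
theorem Reach.solo_step {t : ℝ} {c : Config G Mem Mk} (h : Reach G alg .solo start t c)
    (hG : ∀ e, G.len e = 1) (hp : ¬ c.pending) {v₀ : V} {r₀ : Option (Fin (G.deg v₀))}
    (hT : c.loc .theseus = .node v₀ r₀) {v : V} {r : Option (Fin (G.deg v))}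
    (hA : c.loc .ariadne = .node v r) :
    ∃ c' : Config G Mem Mk, Reach G alg .solo start (t + 1) c' ∧ ¬ c'.pending ∧
      c'.loc .theseus = .node v₀ r₀ ∧
      ((c'.loc .ariadne = .node v r ∧ c'.seen ⊆ c.seen) ∨
        ∃ e s, G.endpoint e s = v ∧ (∃ r', c'.loc .ariadne = .node (G.endpoint e (!s)) r') ∧
          c'.seen ⊆ c.seen ∪ {q | q.1 = e}) := by
  cases hd : alg.depart .ariadne c.mem (c.view .ariadne v r) with
  | none =>
    obtain ⟨h1, h2, h3, h4, h5⟩ := h.solo_move zero_le_one hp hT (by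
      unfold Config.CanMove
      rw [hA]
      exact .inr hd)
    refine ⟨_, h1, h2, h3, .inl ⟨by rw [h4, hA]; rfl, h5.trans ?_⟩⟩
    rw [hA]
    simp
  | some z =>
    obtain ⟨p, k, m⟩ := z
    have h0 := Reach.depart .ariadne v r p k m h hA hd
    obtain ⟨⟨e, s⟩, hq⟩ : ∃ q, G.passage ⟨v, p⟩ = q := ⟨_, rfl⟩
    rw [hq] at h0
    have hv : G.endpoint e s = v := by simp [WGraph.endpoint, ← hq]
    have hl : (c.afterDepart .ariadne (e, s) k m).loc .ariadne = .edge e s 0 := by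
      simp [Config.afterDepart]
    obtain ⟨h1, h2, h3, h4, h5⟩ := h0.solo_move zero_le_one hp
      (by simpa [Config.afterDepart] using hT) (by
        unfold Config.CanMove
        rw [hl]
        simp [Schedule.solo, hG, h.nonneg, add_nonneg h.nonneg])
    rw [hl] at h4 h5
    have h6 := Reach.arrive .ariadne e (!s) _ _ h1 (by simp [h4, WGraph.advance, hG]) rfl
    refine ⟨_, h6, h2, by simpa [Config.afterArrive] using h3,
      .inr ⟨e, s, hv, ⟨some (G.port e !s), by simp [Config.afterArrive]⟩, ?_⟩⟩
    refine h5.trans (union_subset_union_right _ ?_)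
    rintro q ⟨s', x, hq⟩
    cases hq
    rfl

theorem Relation.reflTransGen_of_hub {X : Type*} {R : X → X → Prop} (z : X)
    (h : ∀ x, Relation.ReflTransGen R x z ∧ Relation.ReflTransGen R z x) (x y : X) :
    Relation.ReflTransGen R x y :=
  (h x).1.trans (h y).2

/-- The star with `N` edges of unit length, whose center is `none`. -/
noncomputable def starGraph (N : ℕ) : WGraph (Option (Fin N)) (Fin N) where
  deg v := v.elim N fun _ => 1
  passage :=
    { toFun := fun
        | ⟨none, p⟩ => (p, false)
        | ⟨some e, _⟩ => (e, true)
      invFun := fun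
        | (e, false) => ⟨none, e⟩
        | (e, true) => ⟨some e, (0 : Fin 1)⟩
      left_inv := by
        rintro ⟨_ | e, p⟩
        · rfl
        · exact Sigma.ext rfl (heq_of_eq (Subsingleton.elim (α := Fin 1) _ _))
      right_inv := by
        rintro ⟨e, _ | _⟩ <;> rfl }
  len _ := 1
  len_pos _ := one_pos
  loopless e := (Option.some_ne_none e).symm
  connected := by
    refine Relation.reflTransGen_of_hub none ?_
    rintro (_ | e)
    · exact ⟨.refl, .refl⟩
    · exact ⟨.single ⟨e, true, rfl, rfl⟩, .single ⟨e, false, rfl, rfl⟩⟩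

theorem explorationCost_starGraph (N : ℕ) (alg : TeamAlg Mem Mk) :
    ENNReal.ofReal (2 * N) ≤ explorationCost (starGraph (N + 1)) alg .solo none := by
  -- `S` contains the edges touched so far. Each one costs two units, except that at a leaf the way
  -- back has not been paid yet, whence the `n + 1`.
  have key : ∀ n : ℕ, ∃ c : Config (starGraph (N + 1)) Mem Mk,
      Reach (starGraph (N + 1)) alg .solo (fun _ => none) n c ∧ ¬ c.pending ∧
      c.loc .theseus = .node none none ∧ ∃ S : Finset (Fin (N + 1)), (∀ q ∈ c.seen, q.1 ∈ S) ∧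
      ((∃ r, c.loc .ariadne = .node none r) ∧ 2 * S.card ≤ n ∨
        ∃ e ∈ S, (∃ r, c.loc .ariadne = .node (some e) r) ∧ 2 * S.card ≤ n + 1) := by
    intro n
    induction n with
    | zero => exact ⟨_, by simpa using Reach.init, not_false, rfl, ∅, by simp [initConfig],
        .inl ⟨⟨none, rfl⟩, by simp⟩⟩
    | succ n ih =>
      obtain ⟨c, h, hp, hT, S, hS, hA⟩ := ih
      rcases hA with ⟨⟨r, hA⟩, hn⟩ | ⟨e, he, ⟨r, hA⟩, hn⟩
      · obtain ⟨c', h', hp', hT', hc'⟩ := h.solo_step (fun _ => rfl) hp hT hA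
        refine ⟨c', by exact_mod_cast h', hp', hT', ?_⟩
        rcases hc' with ⟨hl, hs⟩ | ⟨e, s, hv, ⟨r', hl⟩, hs⟩
        · exact ⟨S, fun q hq => hS q (hs hq), .inl ⟨⟨r, hl⟩, by omega⟩⟩
        · cases s
          · refine ⟨insert e S, fun q hq => ?_, .inr ⟨e, by simp, ⟨r', hl⟩, ?_⟩⟩
            · rcases hs hq with hq | hq
              · exact Finset.mem_insert_of_mem (hS q hq)
              · exact Finset.mem_insert.2 (.inl hq)
            · have := Finset.card_insert_le e S
              omega
          · cases hv
      · obtain ⟨c', h', hp', hT', hc'⟩ := h.solo_step (fun _ => rfl) hp hT hA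
        refine ⟨c', by exact_mod_cast h', hp', hT', S, ?_⟩
        rcases hc' with ⟨hl, hs⟩ | ⟨e', s, hv, ⟨r', hl⟩, hs⟩
        · exact ⟨fun q hq => hS q (hs hq), .inr ⟨e, he, ⟨r, hl⟩, by omega⟩⟩
        · cases s
          · cases hv
          · obtain rfl : e' = e := Option.some.inj hv
            refine ⟨fun q hq => ?_, .inl ⟨⟨r', hl⟩, by omega⟩⟩
            rcases hs hq with hq | hq
            · exact hS q hq
            · rw [show q.1 = e' from hq]
              exact he
  obtain ⟨c, h, -, -, S, hS, hA⟩ := key (2 * N)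
  have hcard : S.card < (Finset.univ : Finset (Fin (N + 1))).card := by
    rw [Finset.card_univ, Fintype.card_fin]
    rcases hA with ⟨-, hA⟩ | ⟨-, -, -, hA⟩ <;> omega
  obtain ⟨e, -, he⟩ := Finset.exists_mem_notMem_of_card_lt_card hcard
  have hne : ¬ c.Explored := fun hE =>
    he (hS _ (hE e 2⁻¹ (by simp [starGraph]; norm_num)))
  have ht : Schedule.solo.total ((2 * N : ℕ) : ℝ) = 2 * N := by
    simp [Schedule.total, Schedule.solo]
  rw [← ht]
  exact le_iSup₂_of_le _ c (le_iSup₂_of_le h hne le_rfl)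

theorem two_le_of_explorationCostLE {Ω : Type*} [MeasurableSpace Ω] {P : Measure Ω}
    [IsProbabilityMeasure P] {alg : Ω → TeamAlg Mem Mk} {α : ℝ}
    (h : ExplorationCostLE P alg α) : 2 ≤ α := by
  have key : ∀ N : ℕ, 1 ≤ N → 2 * (N : ℝ) ≤ α * (N + 1) := by
    intro N hN
    have h1 := h _ _ (starGraph (N + 1)) none .solo
    have h2 : ENNReal.ofReal (2 * N) ≤ ENNReal.ofReal (α * (starGraph (N + 1)).totalLength) := by
      refine le_trans ?_ h1
      calc ENNReal.ofReal (2 * N) = ∫⁻ _, ENNReal.ofReal (2 * N) ∂P := by simp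
        _ ≤ _ := lintegral_mono fun ω => explorationCost_starGraph N (alg ω)
    -- Since `ENNReal.ofReal` truncates, the alternative is that the left-hand side is at most zero;
    -- `1 ≤ N` excludes it.
    rw [ENNReal.ofReal_le_ofReal_iff'] at h2
    have hN' : (1 : ℝ) ≤ N := by exact_mod_cast hN
    rcases h2 with h2 | h2
    · simpa [WGraph.totalLength, starGraph] using h2
    · linarith
  by_contra! hα
  -- `key` for `N + 1` says `(2 - α) * (N + 1) ≤ α`, while `(2 - α) * N > |α|`.
  obtain ⟨N, hN⟩ := exists_nat_gt (|α| / (2 - α))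
  have h1 := key (N + 1) (by omega)
  rw [div_lt_iff₀ (by linarith)] at hN
  push_cast at h1
  nlinarith [le_abs_self α]

end Exploration

/-! ### Runs with markers and memory forgotten -/

section Attainability

variable {V E : Type} {Mem Mk : Type*} {G : WGraph V E} {alg : TeamAlg Mem Mk}
  {start : Agent → V}

theorem WGraph.endpoint_passage {v : V} {p : Fin (G.deg v)} {e : E} {s : Bool}
    (h : G.passage ⟨v, p⟩ = (e, s)) : G.endpoint e s = v := by
  simp [WGraph.endpoint, ← h]

theorem WGraph.point_edge_of_mem {e : E} {s : Bool} {x : ℝ} (hx : x ∈ Ioo 0 (G.len e)) :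
    G.point (.edge e s x) = .inr (e, G.coord e s x) := by
  rw [WGraph.point, if_neg hx.1.not_ge, if_neg hx.2.not_ge]

theorem WGraph.point_edge_zero (e : E) (s : Bool) :
    G.point (.edge e s 0) = .inl (G.endpoint e s) := by
  simp [WGraph.point]

theorem WGraph.point_edge_len (e : E) (s : Bool) :
    G.point (.edge e s (G.len e)) = .inl (G.endpoint e (!s)) := by
  simp [WGraph.point, G.len_pos]

theorem WGraph.point_edge_ne_inr {e e' : E} (h : e ≠ e') (s : Bool) (x y : ℝ) :
    G.point (.edge e s x) ≠ .inr (e', y) := by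
  simp only [WGraph.point]
  split_ifs <;> simp [h]

theorem WGraph.point_edge_ne {e e' : E} (h : e ≠ e') (s s' : Bool) (x : ℝ) {y : ℝ}
    (hy : y ∈ Ioo 0 (G.len e')) : G.point (.edge e s x) ≠ G.point (.edge e' s' y) := by
  rw [G.point_edge_of_mem hy]
  exact G.point_edge_ne_inr h s x _

variable (G alg start) in
/-- `Playable` with any markers and any memory. -/
def Attainable (i : Agent) (a b : G.Loc) (w : ℝ) : Prop :=
  ∃ μ m, Playable G alg start i a b μ m w

namespace Attainable

variable {i : Agent} {a b : G.Loc} {w : ℝ}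

theorem symm (h : Attainable G alg start i a b w) : Attainable G alg start i.other b a w := by
  obtain ⟨μ, m, h⟩ := h
  exact ⟨μ, m, h.symm⟩

/-- The agent `i` advances by `d` on the edge `e`, while the other agent waits inside another
edge. -/
theorem advance {e e' : E} {s s' : Bool} {x y d : ℝ} (hne : e ≠ e') (hy : y ∈ Ioo 0 (G.len e'))
    (h : Attainable G alg start i (.edge e s x) (.edge e' s' y) w) (hx : x < G.len e) (hd : 0 ≤ d)
    (hxd : x + d ≤ G.len e) :
    Attainable G alg start i (.edge e s (x + d)) (.edge e' s' y) (w + d) := by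
  obtain ⟨μ, m, h⟩ := h
  refine ⟨μ, m, ?_⟩
  have h1 := h.move hd le_rfl ⟨hx, hxd⟩ ⟨hy.2, by simpa using hy.2.le⟩ fun z _ => by
    rw [mul_zero, G.advance_zero]
    exact G.point_edge_ne hne _ _ _ hy
  rwa [add_zero, G.advance_zero] at h1

/-- The agent `i` goes to the end of the edge `e`, while the other agent waits inside another
edge. -/
theorem finish {e e' : E} {s s' : Bool} {x y : ℝ} (hne : e ≠ e') (hy : y ∈ Ioo 0 (G.len e'))
    (h : Attainable G alg start i (.edge e (!s) x) (.edge e' s' y) w) (hx : x < G.len e) :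
    Attainable G alg start i (.node (G.endpoint e s) (some (G.port e s))) (.edge e' s' y)
      (w + (G.len e - x)) := by
  obtain ⟨μ, m, h⟩ := h.advance hne hy hx (sub_nonneg.2 hx.le) (by simp)
  rw [add_sub_cancel] at h
  classical
  exact ⟨_, _, h.arrive (by simp) (fun _ => rfl) rfl⟩

theorem cross {e e' : E} {s s' : Bool} {y : ℝ} (hne : e ≠ e') (hy : y ∈ Ioo 0 (G.len e'))
    (h : Attainable G alg start i (.edge e (!s) 0) (.edge e' s' y) w) :
    Attainable G alg start i (.node (G.endpoint e s) (some (G.port e s))) (.edge e' s' y)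
      (w + G.len e) := by
  simpa using h.finish hne hy (G.len_pos e)

/-- If the energies are bounded, then an agent at a node leaves it. -/
theorem leave {v : V} {r : Option (Fin (G.deg v))} {e' : E} {s' : Bool} {y B : ℝ}
    (hy : y ∈ Ioo 0 (G.len e'))
    (h : Attainable G alg start i (.node v r) (.edge e' s' y) w)
    (hB : ∀ a b w, Attainable G alg start i a b w → w ≤ B) :
    ∃ e s, G.endpoint e s = v ∧ Attainable G alg start i (.edge e s 0) (.edge e' s' y) w := by
  obtain ⟨μ, m, h⟩ := h
  cases hd : alg.depart i m ⟨G.deg v, fun q => μ (G.passage ⟨v, q⟩), r, false⟩ with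
  | none =>
    have hb : w ≤ B := hB _ _ _ ⟨μ, m, h⟩
    -- An agent that stays can be fed just enough lost energy to exceed `B`.
    have h1 := h.stay ⟨hy.2, by simpa using hy.2.le⟩ (by rw [G.point_edge_of_mem hy]; simp)
      (fun _ => rfl) hd (show 0 ≤ B - w + 1 by linarith)
    have := hB _ _ _ ⟨μ, m, h1⟩
    linarith
  | some z =>
    obtain ⟨p, k, m'⟩ := z
    classical
    obtain ⟨⟨e, s⟩, hq⟩ : ∃ q, G.passage ⟨v, p⟩ = q := ⟨_, rfl⟩
    exact ⟨e, s, G.endpoint_passage hq, _, _, h.depart (by simp) (fun _ => rfl) hd hq⟩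

end Attainable

/-! ### The path with a long middle edge -/

/-- The path with four nodes, in which the length of the middle edge `none` is `x`, and that of the
other edges is `y`. The inner nodes are `(s, false)`, where `p s` is the port of the middle edge. -/
noncomputable def pathGraph (p : Bool → Fin 2) (x y : ℝ) (hx : 0 < x) (hy : 0 < y) :
    WGraph (Bool × Bool) (Option Bool) where
  deg v := cond v.2 1 2
  passage :=
    { toFun := fun
        | ⟨(s, false), q⟩ => if q = p s then (none, s) else (some s, false)
        | ⟨(s, true), _⟩ => (some s, true)
      invFun := fun
        | (none, s) => ⟨(s, false), p s⟩
        | (some s, false) => ⟨(s, false), (p s + 1 : Fin 2)⟩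
        | (some s, true) => ⟨(s, true), (0 : Fin 1)⟩
      left_inv := by
        rintro ⟨⟨s, _ | _⟩, q⟩
        · change Fin 2 at q
          by_cases hq : q = p s
          · simp [hq]
          · have : p s + 1 = q := by omega
            simp [hq, this]
        · exact Sigma.ext rfl (heq_of_eq (Subsingleton.elim (α := Fin 1) _ _))
      right_inv := by
        rintro ⟨_ | s, _ | _⟩ <;> simp }
  len e := e.elim x fun _ => y
  len_pos := by
    rintro (_ | _)
    · exact hx
    · exact hy
  loopless := by
    rintro (_ | s)
    · exact fun h => Bool.false_ne_true (congrArg Prod.fst h)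
    · exact fun h => Bool.false_ne_true (congrArg Prod.snd h)
  connected := by
    refine Relation.reflTransGen_of_hub (false, false) ?_
    rintro ⟨_ | _, _ | _⟩
    · exact ⟨.refl, .refl⟩
    · exact ⟨.single ⟨some false, true, rfl, rfl⟩, .single ⟨some false, false, rfl, rfl⟩⟩
    · exact ⟨.single ⟨none, true, rfl, rfl⟩, .single ⟨none, false, rfl, rfl⟩⟩
    · exact ⟨.head ⟨some true, true, rfl, rfl⟩ (.single ⟨none, true, rfl, rfl⟩),
        .head ⟨none, false, rfl, rfl⟩ (.single ⟨some true, false, rfl, rfl⟩)⟩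

theorem pathGraph_passage {p : Bool → Fin 2} {x y : ℝ} {hx : 0 < x} {hy : 0 < y} (s : Bool)
    (q : Fin 2) : (pathGraph p x y hx hy).passage ⟨(s, false), q⟩ =
      if q = p s then (none, s) else (some s, false) := rfl

theorem pathGraph_totalLength {p : Bool → Fin 2} {x y : ℝ} {hx : 0 < x} {hy : 0 < y} :
    (pathGraph p x y hx hy).totalLength = x + 2 * y := by
  simp [WGraph.totalLength, pathGraph, two_mul]

theorem Fin.eq_add_one_of_ne {p q : Fin 2} (h : q ≠ p) : q = p + 1 := by omega

theorem Fin.ne_add_one (p : Fin 2) : p ≠ p + 1 := by omega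

section Path

variable {p : Bool → Fin 2} {x y : ℝ} {hx : 0 < x} {hy : 0 < y} {start : Agent → Bool × Bool}
  {i : Agent}

/-- When one agent waits inside the first edge of the path, and the other agent is at the second
inner node and may stay forever neither there nor on the last edge, it crosses the middle edge. -/
theorem Attainable.cross_middle {B w z : ℝ}
    (hB : ∀ i a b w, Attainable (pathGraph p x y hx hy) alg start i a b w → w ≤ B)
    (hz : z ∈ Ioo 0 y) {r}
    (h : Attainable (pathGraph p x y hx hy) alg start i (.node (true, false) r)
      (.edge (some false) false z) w) : w + x ≤ B := by
  by_contra! hlt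
  -- As long as the agent avoids the middle edge, it can only go to the leaf and back, and each such
  -- excursion costs at least `y`; so `n` of them are impossible for large `n`.
  have key : ∀ n : ℕ, ∀ r w', w ≤ w' →
      Attainable (pathGraph p x y hx hy) alg start i (.node (true, false) r)
        (.edge (some false) false z) w' → w' + n * y ≤ B := by
    intro n
    induction n with
    | zero => exact fun r w' _ h' => by simpa using hB _ _ _ _ h'
    | succ n ih =>
      intro r w' hw h'
      obtain ⟨e, s, hv, h1⟩ := h'.leave hz (hB i)
      match e, s, hv, h1 with
      | none, true, _, h1 =>
        have h2 : w' + x ≤ B := hB _ _ _ _ (Attainable.cross (s := false) (by simp) hz h1)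
        linarith
      | some true, false, _, h1 =>
        obtain ⟨e, s, hv, h2⟩ := (Attainable.cross (s := true) (by simp) hz h1).leave hz (hB i)
        match e, s, hv, h2 with
        | some true, true, _, h2 =>
          have h3 := ih _ _ (by simp only [pathGraph, Option.elim]; linarith)
            (Attainable.cross (s := false) (by simp) hz h2)
          simp only [pathGraph, Option.elim] at h3
          push_cast
          linarith
        | none, false, hv, _ => cases hv
        | none, true, hv, _ => cases hv
        | some false, false, hv, _ => cases hv
        | some false, true, hv, _ => cases hv
        | some true, false, hv, _ => cases hv
      | none, false, hv, _ => cases hv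
      | some false, false, hv, _ => cases hv
      | some false, true, hv, _ => cases hv
      | some true, true, hv, _ => cases hv
  obtain ⟨n, hn⟩ := exists_nat_gt ((B - w) / y)
  rw [div_lt_iff₀ hy] at hn
  linarith [key n r w le_rfl h]

/-- If the agent `i`, having crossed the middle edge of the path, returns when it sees that the
other agent has left to the last edge, then the middle edge is crossed three times. -/
theorem three_mul_le_of_return {pi po : Fin 2} {k₁ k₂ k₃ : Mk} {m₁ m₂ m₃ : Mem} {B : ℝ}
    (hB : ∀ i a b w,
      Attainable (pathGraph (fun s => cond s (po + 1) pi) x y hx hy) alg start i a b w → w ≤ B)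
    (hs : start i = (false, false)) (hs' : start i.other = (true, false))
    (h₁ : alg.depart i alg.init ⟨2, fun _ => alg.blank, none, false⟩ = some (pi, k₁, m₁))
    (h₂ : alg.depart i.other m₁ ⟨2, fun _ => alg.blank, none, false⟩ = some (po, k₂, m₂))
    (h₃ : alg.arrive i m₂ ⟨2, fun q => if q = po then k₂ else alg.blank, some (po + 1), false⟩ x =
      (k₃, m₃))
    (h₄ : ∀ k m, alg.depart i m₃ ⟨2, fun q => if q = po then k₂ else k₃, some (po + 1), false⟩ ≠
      some (po, k, m)) : 3 * x ≤ B := by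
  set G := pathGraph (fun s => cond s (po + 1) pi) x y hx hy with hG
  have hne : start .ariadne ≠ start .theseus := by
    cases i <;> simp only [Agent.other] at hs' <;> simp [hs, hs']
  have hy2 : y / 2 ∈ Ioo 0 y := ⟨by linarith, by linarith⟩
  have s₀ := Playable.init (G := G) (alg := alg) hne i
  rw [hs, hs'] at s₀
  have hpo : (po : Fin 2) ≠ po + 1 := Fin.ne_add_one po
  have hν : ∀ (μ : Option Bool × Bool → Mk), ∀ q : Fin 2, μ (G.passage ⟨(true, false), q⟩) =
      if q = po then μ (some true, false) else μ (none, true) := by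
    intro μ q
    change μ (ite (q = po + 1) _ _) = _
    by_cases hq : q = po
    · rw [if_pos hq, if_neg (hq ▸ hpo)]
    · rw [if_neg hq, if_pos (Fin.eq_add_one_of_ne hq)]
  have s₁ := s₀.depart (by simp) (fun _ => rfl) h₁ (e := none) (s := false)
    ((pathGraph_passage false pi).trans (if_pos rfl))
  have s₂ := s₁.symm.depart (by simp) (ν := fun _ => alg.blank)
    (fun q => (hν _ q).trans (by split_ifs <;> simp)) h₂ (e := some true) (s := false)
    ((pathGraph_passage true po).trans (if_neg hpo))
  -- The other agent is stopped halfway on the last edge, where it stays out of sight of both inner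
  -- nodes.
  have s₃ := s₂.symm.move (d := x) (d' := y / 2) hx.le hy2.1.le ⟨hx, (zero_add x).le⟩
    ⟨hy, (zero_add (y / 2)).trans_le hy2.2.le⟩ (by
      rintro z ⟨hz0, hz1⟩
      rcases hz0.eq_or_lt with rfl | hz0
      · simp only [zero_mul, WGraph.advance_zero, WGraph.point_edge_zero]
        intro h
        cases h
      · refine WGraph.point_edge_ne (by simp) _ _ _ ⟨?_, ?_⟩
        · simp only [zero_add]
          exact mul_pos hz0 hy2.1
        · simp only [zero_add]
          change z * (y / 2) < y
          nlinarith)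
  simp only [WGraph.advance, zero_add] at s₃
  rw [Agent.other_other] at s₃
  have s₄ := s₃.arrive (e := none) (s := true) (by simp) (hν _) h₃
  have hlen : G.len none = x := rfl
  have hlen' : ∀ s, G.len (some s) = y := fun s => rfl
  -- Not following, and unable to stay forever, the agent has to go back through the middle edge.
  have s₅ : Attainable G alg start i (.edge none true 0) (.edge (some true) false (y / 2))
      (x + y / 2) := by
    cases hd : alg.depart i m₃ ⟨2, fun q => if q = po then k₂ else k₃, some (po + 1), false⟩ with
    | none =>
      have hb := hB _ _ _ _ ⟨_, _, s₄⟩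
      have h := s₄.stay ⟨hy2.2, (add_zero (y / 2)).trans_le hy2.2.le⟩
        (by rw [WGraph.point_edge_of_mem hy2]; simp) (hν _) hd
        (show 0 ≤ B - (x + y / 2) + 1 by linarith)
      linarith [hB _ _ _ _ ⟨_, _, h⟩]
    | some z =>
      obtain ⟨q, k, m⟩ := z
      change Fin 2 at q
      have hq : q = po + 1 := Fin.eq_add_one_of_ne fun hq => h₄ k m (hq ▸ hd)
      exact ⟨_, _, s₄.depart (by simp) (hν _) hd ((pathGraph_passage true q).trans (if_pos hq))⟩
  have s₆ := Attainable.cross (s := false) (by simp) hy2 s₅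
  -- Either it crosses the middle edge for the third time, or it enters the first edge.
  obtain ⟨e, s, hv, s₇⟩ := s₆.leave hy2 (hB i)
  match e, s, hv, s₇ with
  | none, false, _, s₇ =>
    have h := hB _ _ _ _ (Attainable.cross (s := true) (by simp) hy2 s₇)
    linarith
  | some false, false, _, s₇ =>
    -- The roles are exchanged: this agent is frozen halfway on the first edge, and the other one,
    -- after its visit to the leaf, is the one that must cross the middle edge for the third time.
    have s₈ := (s₇.advance (by simp) hy2 hy hy2.1.le ((zero_add (y / 2)).trans_le hy2.2.le)).symm
    rw [zero_add] at s₈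
    have s₉ := Attainable.finish (s := true) (by simp) hy2 s₈ hy2.2
    obtain ⟨e, s, hv, t₁⟩ := s₉.leave hy2 (hB _)
    match e, s, hv, t₁ with
    | some true, true, _, t₁ =>
      have t₂ := Attainable.cross (s := false) (by simp) hy2 t₁
      have := t₂.cross_middle hB hy2
      rw [hlen, hlen'] at this
      linarith
    | none, false, hv, _ => cases hv
    | none, true, hv, _ => cases hv
    | some false, false, hv, _ => cases hv
    | some false, true, hv, _ => cases hv
    | some true, false, hv, _ => cases hv
  | none, true, hv, _ => cases hv
  | some true, false, hv, _ => cases hv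
  | some true, true, hv, _ => cases hv
  | some false, true, hv, _ => cases hv

end Path

end Attainability

/-! ### The cycle with two nodes -/

section Cycle

variable {Mem Mk : Type*} {alg : TeamAlg Mem Mk}

/-- The cycle with two nodes: the edge `b`, of length `x b`, goes from the port `p b` of the node
`b` to the other node. -/
noncomputable def cycleGraph (p : Bool → Fin 2) (x : Bool → ℝ) (hx : ∀ b, 0 < x b) :
    WGraph Bool Bool where
  deg _ := 2
  passage :=
    { toFun := fun ⟨v, q⟩ => if q = p v then (v, false) else (!v, true)
      invFun := fun
        | (b, false) => ⟨b, p b⟩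
        | (b, true) => ⟨!b, p (!b) + 1⟩
      left_inv := by
        rintro ⟨v, q⟩
        by_cases hq : q = p v
        · simp [hq]
        · have := Fin.eq_add_one_of_ne hq
          subst this
          simp
      right_inv := by
        rintro ⟨b, _ | _⟩ <;> simp }
  len := x
  len_pos := hx
  loopless := by
    rintro (_ | _) <;> exact fun h => by cases h
  connected := by
    refine Relation.reflTransGen_of_hub false ?_
    rintro (_ | _)
    · exact ⟨.refl, .refl⟩
    · exact ⟨.single ⟨true, false, rfl, rfl⟩, .single ⟨false, false, rfl, rfl⟩⟩

variable {p : Bool → Fin 2} {x : Bool → ℝ} {hx : ∀ b, 0 < x b}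

theorem cycleGraph_passage (v : Bool) (q : Fin 2) :
    (cycleGraph p x hx).passage ⟨v, q⟩ = if q = p v then (v, false) else (!v, true) := rfl

theorem cycleGraph_totalLength : (cycleGraph p x hx).totalLength = x false + x true := by
  simp [WGraph.totalLength, cycleGraph, add_comm]

/-- Moving around the cycle in the same direction, at speeds proportional to the lengths of their
edges, the agents are on different edges all the time and reach opposite nodes simultaneously. -/
theorem cycleGraph_point_ne {b b' : Bool} (h : b ≠ b') {z : ℝ} (hz : z ∈ Icc (0 : ℝ) 1) :
    (cycleGraph p x hx).point (.edge b false (z * x b)) ≠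
      (cycleGraph p x hx).point (.edge b' false (z * x b')) := by
  rcases hz.1.eq_or_lt with rfl | h0
  · simp only [zero_mul, WGraph.point_edge_zero]
    exact fun h' => h (Sum.inl.inj h')
  rcases hz.2.eq_or_lt with rfl | h1
  · simp only [one_mul]
    have this : ∀ b, (cycleGraph p x hx).point (.edge b false (x b)) = .inl (!b) :=
      fun b => WGraph.point_edge_len b false
    rw [this, this]
    exact fun h' => h (Bool.not_inj (Sum.inl.inj h'))
  · exact WGraph.point_edge_ne h _ _ _ ⟨mul_pos h0 (hx _), mul_lt_of_lt_one_left (hx _) h1⟩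

/-- The view at a node of degree two, entered through the port opposite to `q₀`, the markers on
`q₀` and on the opposite port being `k` and `k'`. -/
abbrev View.two {Mk : Type*} (q₀ : Fin 2) (k k' : Mk) : View Mk :=
  ⟨2, fun q => if q = q₀ then k else k', some (q₀ + 1), false⟩

/-- When both agents cross the two edges of the cycle in the same direction, each edge is crossed
twice without a meeting, and Theseus is free to cross the edge that he chooses next. -/
theorem cycle_third_crossing {start : Agent → Bool} {B : ℝ} {k₁ k₂ k₃ k₄ k₅ k₆ k₇ k₈ : Mk}
    {m₁ m₂ m₃ m₄ m₅ m₆ m₇ m₈ : Mem}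
    (hB : ∀ i a b w, Attainable (cycleGraph p x hx) alg start i a b w → w ≤ B)
    (hs : start .ariadne = false) (hs' : start .theseus = true)
    (h₁ : alg.depart .ariadne alg.init ⟨2, fun _ => alg.blank, none, false⟩ =
      some (p false, k₁, m₁))
    (h₂ : alg.depart .theseus m₁ ⟨2, fun _ => alg.blank, none, false⟩ = some (p true, k₂, m₂))
    (h₃ : alg.arrive .ariadne m₂ (.two (p true) k₂ alg.blank) (x false) = (k₃, m₃))
    (h₄ : alg.arrive .theseus m₃ (.two (p false) k₁ alg.blank) (x true) = (k₄, m₄))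
    (h₅ : alg.depart .ariadne m₄ (.two (p true) k₂ k₃) = some (p true, k₅, m₅))
    (h₆ : alg.depart .theseus m₅ (.two (p false) k₁ k₄) = some (p false, k₆, m₆))
    (h₇ : alg.arrive .ariadne m₆ (.two (p false) k₆ k₄) (x true) = (k₇, m₇))
    (h₈ : alg.arrive .theseus m₇ (.two (p true) k₅ k₃) (x false) = (k₈, m₈)) :
    ∃ q k m, alg.depart .theseus m₈ (.two (p true) k₅ k₈) = some (q, k, m) ∧
      2 * (x false + x true) + (if q = p true then x true else x false) ≤ B := by
  set G := cycleGraph p x hx with hG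
  have hν : ∀ (v : Bool) (μ : Bool × Bool → Mk), ∀ q : Fin 2, μ (G.passage ⟨v, q⟩) =
      if q = p v then μ (v, false) else μ (!v, true) := by
    intro v μ q
    change μ (ite (q = p v) _ _) = _
    split_ifs <;> rfl
  have hfirst : ∀ v, G.passage ⟨v, p v⟩ = (v, false) := fun v =>
    (cycleGraph_passage v (p v)).trans (if_pos rfl)
  have s₀ := Playable.init (G := G) (alg := alg) (start := start) (by simp [hs, hs']) .ariadne
  rw [show Agent.other .ariadne = .theseus from rfl, hs, hs'] at s₀
  have s₁ := s₀.depart (by simp) (fun _ => rfl) h₁ (hfirst false)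
  have s₂ := s₁.symm.depart (by simp) (fun q => (hν _ _ q).trans (by split_ifs <;> simp)) h₂
    (hfirst true)
  have s₃ := s₂.symm.move (d := x false) (d' := x true) (hx _).le (hx _).le
    ⟨hx _, (zero_add (x false)).le⟩ ⟨hx _, (zero_add (x true)).le⟩ fun z hz => by
      simpa [WGraph.advance] using cycleGraph_point_ne (by simp) hz
  simp only [WGraph.advance, zero_add] at s₃
  have s₄ := s₃.arrive (e := false) (s := true) (by simp) (hν true _) h₃
  have s₅ := s₄.symm.arrive (e := true) (s := true) (by intro r h; cases h) (hν false _) h₄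
  have s₆ := s₅.symm.depart (by intro r h; cases h) (hν true _) h₅ (hfirst true)
  have s₇ := s₆.symm.depart (by simp) (hν false _) h₆ (hfirst false)
  have s₈ := s₇.symm.move (d := x true) (d' := x false) (hx _).le (hx _).le
    ⟨hx _, (zero_add (x true)).le⟩ ⟨hx _, (zero_add (x false)).le⟩ fun z hz => by
      simpa [WGraph.advance] using cycleGraph_point_ne (by simp) hz
  simp only [WGraph.advance, zero_add] at s₈
  have s₉ := s₈.arrive (e := true) (s := true) (by simp) (hν false _) h₇
  have t₁ := s₉.symm.arrive (e := false) (s := true) (by intro r h; cases h) (hν true _) h₈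
  set W := x false + x true + x true + x false with hW
  cases hd : alg.depart .theseus m₈ (.two (p true) k₅ k₈) with
  | none =>
    have hb := hB _ _ _ _ ⟨_, _, t₁⟩
    have h := t₁.stay rfl (by intro h; cases h) (hν true _) hd (show 0 ≤ B - W + 1 by linarith)
    linarith [hB _ _ _ _ ⟨_, _, h⟩]
  | some z =>
    obtain ⟨q, k, m⟩ := z
    change Fin 2 at q
    refine ⟨q, k, m, rfl, ?_⟩
    obtain ⟨b, s, hq, hv, hb⟩ : ∃ b s, G.passage ⟨true, q⟩ = (b, s) ∧ G.endpoint b s = true ∧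
        (if q = p true then x true else x false) = x b := by
      by_cases h : q = p true
      · exact ⟨true, false, (cycleGraph_passage _ _).trans (if_pos h), rfl, if_pos h⟩
      · exact ⟨false, true, (cycleGraph_passage _ _).trans (if_neg h), rfl, if_neg h⟩
    rw [hb]
    have t₂ := t₁.depart (by intro r h; cases h) (hν true _) hd hq
    -- At the end of the third edge Theseus would meet Ariadne, who waits at the other node; the
    -- bound is a limit over the points before that end.
    refine le_of_forall_lt_imp_le_of_dense fun c hc => ?_
    by_cases hc0 : c ≤ W
    · exact hc0.trans (hB _ _ _ _ ⟨_, _, t₂⟩)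
    · have hlt : c - W < x b := by linarith
      have t₃ := t₂.move (d := c - W) (by linarith) le_rfl
        ⟨hx b, (zero_add (c - W)).trans_le hlt.le⟩ rfl fun z hz => by
          simp only [WGraph.advance, zero_add]
          rcases (mul_nonneg hz.1 (by linarith : 0 ≤ c - W)).eq_or_lt with h0 | h0
          · rw [← h0, WGraph.point_edge_zero, hv]
            intro h
            cases h
          · rw [WGraph.point_edge_of_mem
              ⟨h0, (mul_le_of_le_one_left (by linarith) hz.2).trans_lt hlt⟩]
            intro h
            cases h
      linarith [hB _ _ _ _ ⟨_, _, t₃⟩]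

end Cycle

/-! ### Lower bounds for rendezvous -/

section Rendezvous

variable {MemA MemT Mk : Type*} {R : RendezvousAlg MemA MemT Mk} {α : ℝ}

theorem RendezvousCostLE.mono (h : RendezvousCostLE R α) {β : ℝ} (hαβ : α ≤ β) :
    RendezvousCostLE R β := fun V E _ _ G start hs σ =>
  (h V E G start hs σ).trans <| ENNReal.ofReal_le_ofReal <|
    mul_le_mul_of_nonneg_right hαβ <| Finset.sum_nonneg fun e _ => (G.len_pos e).le

theorem RendezvousCostLE.attainable_le (h : RendezvousCostLE R α) (hα : 0 ≤ α) {V E : Type}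
    [Finite V] [Fintype E] {G : WGraph V E} {start : Agent → V}
    (hs : start .ariadne ≠ start .theseus) (i : Agent) (a b : G.Loc) (w : ℝ)
    (hw : Attainable G R.team start i a b w) : w ≤ α * G.totalLength := by
  obtain ⟨μ, m, hw⟩ := hw
  exact hw.energy_le (mul_nonneg hα <| Finset.sum_nonneg fun e _ => (G.len_pos e).le)
    (h V E G start hs)

/-- Distinct initial nodes on the cycle. -/
def cycleStart : Agent → Bool
  | .ariadne => false
  | .theseus => true

/-- Distinct initial nodes on the path, the agent `i` being at the first inner node. -/
def pathStart : Agent → Agent → Bool × Bool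
  | .ariadne, .ariadne => (false, false)
  | .ariadne, .theseus => (true, false)
  | .theseus, .ariadne => (true, false)
  | .theseus, .theseus => (false, false)

/-- The initial view is the same at all nodes of degree two, so one test graph suffices: an agent
that stays there, while the other receives nothing, wastes unbounded energy. -/
theorem RendezvousCostLE.depart_init (h : RendezvousCostLE R α) (hα : 0 ≤ α) (i : Agent) :
    ∃ q k m, R.team.depart i R.team.init ⟨2, fun _ => R.team.blank, none, false⟩ =
      some (q, k, m) := by
  cases hd : R.team.depart i R.team.init ⟨2, fun _ => R.team.blank, none, false⟩ with
  | some z => exact ⟨z.1, z.2.1, z.2.2, rfl⟩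
  | none =>
    have hB := h.attainable_le hα (G := cycleGraph (fun _ => 0) (fun _ => 1) fun _ => one_pos)
      (start := cycleStart) Bool.false_ne_true
    set B := α * (cycleGraph (fun _ => 0) (fun _ => 1) fun _ => one_pos).totalLength
    have s₀ := Playable.init (G := cycleGraph (fun _ => 0) (fun _ => 1) fun _ => one_pos)
      (alg := R.team) (start := cycleStart) Bool.false_ne_true i
    have hb := hB _ _ _ _ ⟨_, _, s₀⟩
    have h1 := s₀.stay rfl (by cases i <;> exact fun h => by cases h) (fun _ => rfl) hd
      (show 0 ≤ B + 1 by linarith)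
    linarith [hB _ _ _ _ ⟨_, _, h1⟩]

/-- If the ratio is less than three, then an agent which has crossed a first edge, and sees that the
other agent has left, follows it. -/
theorem RendezvousCostLE.follow (h : RendezvousCostLE R α) (hα : 0 ≤ α) (hα3 : α < 3) (i : Agent)
    {pi po : Fin 2} {k₁ k₂ k₃ : Mk} {m₁ m₂ m₃ : MemA × MemT} {x : ℝ} (hx : 0 < x)
    (h₁ : R.team.depart i R.team.init ⟨2, fun _ => R.team.blank, none, false⟩ = some (pi, k₁, m₁))
    (h₂ : R.team.depart i.other m₁ ⟨2, fun _ => R.team.blank, none, false⟩ = some (po, k₂, m₂))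
    (h₃ : R.team.arrive i m₂ (.two po k₂ R.team.blank) x = (k₃, m₃)) :
    ∃ k m, R.team.depart i m₃ (.two po k₂ k₃) = some (po, k, m) := by
  by_contra! h₄
  -- The outer edges are so short that `2 * α * y < (3 - α) * x`, that is, `α * L < 3 * x`.
  have hy : 0 < (3 - α) * x / 12 := by
    have := mul_pos (sub_pos.2 hα3) hx
    positivity
  have h1 := three_mul_le_of_return (hx := hx) (hy := hy) (start := pathStart i)
    (h.attainable_le hα (by cases i <;> simp [pathStart])) (by cases i <;> rfl)
    (by cases i <;> rfl) h₁ h₂ h₃ h₄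
  rw [pathGraph_totalLength] at h1
  nlinarith [mul_pos (sub_pos.2 hα3) hx]

/-- If the ratio is less than three, then on the cycle with edge lengths `e` and `f` each agent
crosses both edges; the memory `τ f` of Theseus when he leaves for the second time does not depend
on `e`, and it determines with `e` the edge that he chooses the third time. -/
theorem RendezvousCostLE.exists_third_choice (h : RendezvousCostLE R α) (hα : 0 ≤ α)
    (hα3 : α < 3) : ∃ (τ : ℝ → MemT) (Q : ℝ → MemT → Prop), ∀ e f, 0 < e → 0 < f →
      (Q e (τ f) → 2 * (e + f) + f ≤ α * (e + f)) ∧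
      (¬ Q e (τ f) → 2 * (e + f) + e ≤ α * (e + f)) := by
  obtain ⟨pA, kA, a₁, hA⟩ : ∃ p k a, R.ariadne.depart R.ariadne.init
      ⟨2, fun _ => R.blank, none, false⟩ = some (p, k, a) := by
    obtain ⟨q, k, m, hd⟩ := h.depart_init hα .ariadne
    obtain ⟨z, hz, -⟩ := Option.map_eq_some_iff.1 hd
    exact ⟨_, _, _, hz⟩
  obtain ⟨pT, kT, b₁, hT⟩ : ∃ p k a, R.theseus.depart R.theseus.init
      ⟨2, fun _ => R.blank, none, false⟩ = some (p, k, a) := by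
    obtain ⟨q, k, m, hd⟩ := h.depart_init hα .theseus
    obtain ⟨z, hz, -⟩ := Option.map_eq_some_iff.1 hd
    exact ⟨_, _, _, hz⟩
  change Fin 2 at pA pT
  have hA' : ∀ b, R.team.depart .ariadne (R.ariadne.init, b) ⟨2, fun _ => R.blank, none, false⟩ =
      some (pA, kA, (a₁, b)) := fun b => by simp [RendezvousAlg.team, hA]
  have hT' : ∀ a, R.team.depart .theseus (a, R.theseus.init) ⟨2, fun _ => R.blank, none, false⟩ =
      some (pT, kT, (a, b₁)) := fun a => by simp [RendezvousAlg.team, hT]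
  -- The only nonblank marker seen on the first arrival was written before its author had learned
  -- any length, so the outcome depends only on the length just crossed: `e` for Ariadne, `f` for
  -- Theseus.
  set A₂ : ℝ → Mk × MemA := fun e => R.ariadne.arrive a₁ (.two pT kT R.blank) e
  set T₂ : ℝ → Mk × MemT := fun f => R.theseus.arrive b₁ (.two pA kA R.blank) f
  have hA₃ : ∀ e, 0 < e → ∃ k a, R.ariadne.depart (A₂ e).2 (.two pT kT (A₂ e).1) =
      some (pT, k, a) := by
    intro e he
    obtain ⟨k, m, hd⟩ := h.follow hα hα3 .ariadne he (hA' _) (hT' _) (k₃ := (A₂ e).1)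
      (m₃ := ((A₂ e).2, b₁)) rfl
    obtain ⟨z, hz, hz'⟩ := Option.map_eq_some_iff.1 hd
    simp only [Prod.mk.injEq] at hz'
    exact ⟨z.2.1, z.2.2, by rw [hz, ← hz'.1]⟩
  have hT₃ : ∀ f, 0 < f → ∃ k b, R.theseus.depart (T₂ f).2 (.two pA kA (T₂ f).1) =
      some (pA, k, b) := by
    intro f hf
    obtain ⟨k, m, hd⟩ := h.follow hα hα3 .theseus hf (hT' _) (hA' _) (k₃ := (T₂ f).1)
      (m₃ := (a₁, (T₂ f).2)) rfl
    obtain ⟨z, hz, hz'⟩ := Option.map_eq_some_iff.1 hd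
    simp only [Prod.mk.injEq] at hz'
    exact ⟨z.2.1, z.2.2, by rw [hz, ← hz'.1]⟩
  have : Nonempty Mk := ⟨R.blank⟩
  have : Nonempty MemA := ⟨R.ariadne.init⟩
  have : Nonempty MemT := ⟨R.theseus.init⟩
  choose! kA₃ a₃ hA₃ using hA₃
  choose! kT₃ τ hT₃ using hT₃
  -- `Q e b` says that Theseus, having left for the second time with memory `b`, next takes `pT`,
  -- which leads to the edge of length `f`. The markers that he finds on his return were both
  -- written by Ariadne before she learned `f`; hence `f` enters through `b` only.
  refine ⟨τ, fun e b => ∃ k m, R.theseus.depart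
    (R.theseus.arrive b (.two pT (kA₃ e) (A₂ e).1) e).2
    (.two pT (kA₃ e) (R.theseus.arrive b (.two pT (kA₃ e) (A₂ e).1) e).1) = some (pT, k, m),
    fun e f he hf => ?_⟩
  set x : Bool → ℝ := fun b => cond b f e
  have hx0 : ∀ b, 0 < x b := by
    rintro (_ | _)
    exacts [he, hf]
  obtain ⟨q, k, m, hd, hle⟩ := cycle_third_crossing (p := fun b => cond b pT pA) (x := x)
    (hx := hx0) (alg := R.team) (start := cycleStart)
    (h.attainable_le hα Bool.false_ne_true) rfl rfl (hA' _) (hT' _)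
    (k₃ := (A₂ e).1) (m₃ := ((A₂ e).2, b₁)) rfl
    (k₄ := (T₂ f).1) (m₄ := ((A₂ e).2, (T₂ f).2)) rfl
    (k₅ := kA₃ e) (m₅ := (a₃ e, (T₂ f).2)) (by simp [RendezvousAlg.team, hA₃ e he])
    (k₆ := kT₃ f) (m₆ := (a₃ e, τ f)) (by simp [RendezvousAlg.team, hT₃ f hf]) rfl rfl
  obtain ⟨z, hz, hz'⟩ := Option.map_eq_some_iff.1 hd
  simp only [Prod.mk.injEq] at hz'
  rw [cycleGraph_totalLength] at hle
  refine ⟨fun ⟨k', m', hQ⟩ => ?_, fun hQ => ?_⟩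
  · have hq : q = pT := by
      have := hz.symm.trans hQ
      rw [← hz'.1, Option.some.inj this]
    rw [if_pos (c := q = cond true pT pA) hq] at hle
    exact hle
  · have hq : ¬ q = cond true pT pA := fun hq =>
      hQ ⟨z.2.1, z.2.2, hz.trans (congrArg some (Prod.ext (hz'.1.trans hq) rfl))⟩
    rw [if_neg hq] at hle
    exact hle

theorem five_halves_le_of_rendezvousCostLE (h : RendezvousCostLE R α) : 5 / 2 ≤ α := by
  -- The cost bound is truncated at zero, so a negative `α` may be replaced by zero.
  suffices 5 / 2 ≤ max α 0 by
    rcases le_max_iff.1 this with h | h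
    · exact h
    · norm_num at h
  by_contra! hα
  obtain ⟨τ, Q, hQ⟩ := (h.mono (le_max_left α 0)).exists_third_choice (le_max_right α 0)
    (by linarith)
  have h1 := hQ 1 1 one_pos one_pos
  by_cases hq : Q 1 (τ 1)
  · linarith [h1.1 hq]
  · linarith [h1.2 hq]

theorem three_le_of_rendezvousCostLE [Finite MemT] (h : RendezvousCostLE R α) : 3 ≤ α := by
  have hα := five_halves_le_of_rendezvousCostLE h
  by_contra! hα3
  obtain ⟨τ, Q, hQ⟩ := h.exists_third_choice (by linarith) hα3
  -- `K` is a ratio of lengths beyond which crossing the longer edge three times and the shorter one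
  -- twice costs more than `α` times their sum.
  obtain ⟨K, hK1, hK⟩ : ∃ K : ℝ, 1 ≤ K ∧ α < (3 - α) * K :=
    ⟨max 1 (α / (3 - α) + 1), le_max_left _ _, by
      have := le_max_right 1 (α / (3 - α) + 1)
      have h2 : α < (3 - α) * (α / (3 - α) + 1) := by
        rw [mul_add, mul_div_cancel₀ _ (by linarith)]
        linarith
      exact h2.trans_le (mul_le_mul_of_nonneg_left this (by linarith))⟩
  have key : ∀ s l : ℝ, 0 < s → K * s ≤ l → ¬ 2 * (s + l) + l ≤ α * (s + l) := by
    intro s l hs hl hle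
    nlinarith [mul_le_mul_of_nonneg_left hl (by linarith : 0 ≤ 3 - α)]
  obtain ⟨n, n', hn, hτ⟩ : ∃ n n' : ℕ, n < n' ∧ τ (K ^ (2 * n)) = τ (K ^ (2 * n')) := by
    obtain ⟨n, n', hne, hτ⟩ := Finite.exists_ne_map_eq_of_infinite fun n : ℕ => τ (K ^ (2 * n))
    rcases hne.lt_or_gt with hlt | hlt
    · exact ⟨n, n', hlt, hτ⟩
    · exact ⟨n', n, hlt, hτ.symm⟩
  have hpos : ∀ j : ℕ, 0 < K ^ j := fun j => pow_pos (by linarith) j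
  -- The odd power is `K` times the smaller even one and at most the larger one divided by `K`. If
  -- Theseus prefers the edge of length `f`, the larger `f` is used, otherwise the smaller one; his
  -- memory is the same for both.
  by_cases hq : Q (K ^ (2 * n + 1)) (τ (K ^ (2 * n)))
  · refine key (K ^ (2 * n + 1)) (K ^ (2 * n')) (hpos _) ?_
      ((hQ _ _ (hpos _) (hpos _)).1 (hτ ▸ hq))
    rw [← pow_succ']
    exact pow_le_pow_right₀ hK1 (by omega)
  · refine key (K ^ (2 * n)) (K ^ (2 * n + 1)) (hpos _) (pow_succ' K (2 * n)).ge ?_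
    rw [add_comm (K ^ (2 * n))]
    exact (hQ _ _ (hpos _) (hpos _)).2 hq

end Rendezvous

theorem mainTheorem5 (α : ℝ) :
    (∀ (Ω : Type*) [MeasurableSpace Ω] (P : Measure Ω) [IsProbabilityMeasure P]
        (Mem Mk : Type*) (alg : Ω → TeamAlg Mem Mk),
        ExplorationCostLE P alg α → 2 ≤ α) ∧
    (∀ (MemA MemT Mk : Type*) (R : RendezvousAlg MemA MemT Mk),
        RendezvousCostLE R α → 5 / 2 ≤ α) ∧
    (∀ (MemA MemT Mk : Type*) [Finite MemA] [Finite MemT] [Finite Mk]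
        (R : RendezvousAlg MemA MemT Mk),
        RendezvousCostLE R α → 3 ≤ α) :=
  ⟨fun _ _ _ _ _ _ _ h => two_le_of_explorationCostLE h,
    fun _ _ _ _ h => five_halves_le_of_rendezvousCostLE h,
    fun _ _ _ _ _ _ _ h => three_le_of_rendezvousCostLE h⟩
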